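/- Let $\varphi:\mathbb{C}^2\times\mathbb{C}^2\to\mathbb{C}$, $\varphi((x_1,x_2),(y_1,y_2))=(x_1-y_1)^2+(x_2-y_2)^2$. Let $f:\mathbb{C}^2\to\mathbb{C}^2$ be a mapping that preserves unit distance, that is, for all $X,Y\in\mathbb{C}^2$, $\varphi(X,Y)=1$ implies $\varphi(f(X),f(Y))=1$. Then there exist a field homomorphism $\gamma:\mathbb{C}\to\mathbb{C}$ and a ($\mathbb{C}$-)affine mapping $I:\mathbb{C}^2\to\mathbb{C}^2$ with orthogonal linear part (that is, the linear part of $I$ preserves the symmetric bilinear form $x_1y_1+x_2y_2$) such that $f=I\circ(\gamma,\gamma)$, i.e. $f((x_1,x_2))=I((\gamma(x_1),\gamma(x_2)))$ for all $x_1,x_2\in\mathbb{C}$. -/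

import Mathlib

/-- The form `φ(X, Y) = (x₁ - y₁)² + (x₂ - y₂)²` on `ℂ²` (no complex conjugation). -/
def phi (X Y : Fin 2 → ℂ) : ℂ := (X 0 - Y 0) ^ 2 + (X 1 - Y 1) ^ 2

/-- `f : ℂ² → ℂ²` preserves the distance `d` if `φ(X, Y) = d²` implies `φ(f X, f Y) = d²`. -/
def PreservesDistance (d : ℝ) (f : (Fin 2 → ℂ) → (Fin 2 → ℂ)) : Prop :=
  ∀ X Y : Fin 2 → ℂ, phi X Y = (d : ℂ) ^ 2 → phi (f X) (f Y) = (d : ℂ) ^ 2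

/-- A linear map of `ℂ²` is orthogonal if it preserves the standard symmetric bilinear form
`x₁ y₁ + x₂ y₂` (the bilinear form of `φ`, not the Hermitian one). -/
def IsOrthogonalMap (L : (Fin 2 → ℂ) →ₗ[ℂ] (Fin 2 → ℂ)) : Prop :=
  ∀ x y : Fin 2 → ℂ, L x 0 * L y 0 + L x 1 * L y 1 = x 0 * y 0 + x 1 * y 1

/-!
In the null coordinates `u = x₁ + i x₂`, `v = x₁ - i x₂` the form `φ` becomes `Δu Δv`, so `f` turns
into a map `g` of `ℂ × ℂ` that preserves the relation `Δu Δv = 1`. The proof has two halves.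

*`g - g 0` is additive.* Two equilateral unit triangles glued along a side have their outer vertices
at squared distance `3`, and the two apexes over a unit side are the only common neighbours of its
ends. Hence `g` either identifies the outer vertices or maps the rhombus to a rhombus; the former is
excluded by an isosceles triangle with squared sides `3`, `3`, `1` (`unit_rhombus`). Walking along a
strip of such triangles shows `g (A + 2w) = 2 g (A + w) - g A` for unit `w`
(`map_add_two_unit`). For unit `w`, `w'` the second difference `d` of `g` along `w`, `w'` then
satisfies `N (b + n d) = 1` for `n = 0, 1, 2`, where `N b = 1`; as `b` is anisotropic this forces
`d = 0` (`map_add_unit_add_unit`). Unit vectors generate the plane, so `g - g 0` is additive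
(`map_add_sub_map_zero`).

*Additive maps preserving unit vectors.* Comparing the images of `(t, t⁻¹)`, `(2t, (2t)⁻¹)` and
`(3t, (3t)⁻¹)` shows that the matrix of additive maps representing `g - g 0` is diagonal or
antidiagonal, and its two nonzero entries satisfy `a t * d t⁻¹ = 1`. By the identity
`t⁻¹ - (t + 1)⁻¹ = (t ^ 2 + t)⁻¹`, as in Hua's theorem, `a` and `d` are then multiples of one field
homomorphism (`exists_ringHom_of_mul_map_inv`).
-/

/-! ### Maps of the hyperbolic plane preserving unit vectors -/

/-- `g` preserves the relation "the difference has norm `1`" for the hyperbolic norm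
`N (u, v) = u * v` on `K × K`. -/
def PreservesHyperbolicUnit {K : Type*} [Field K] (g : K × K → K × K) : Prop :=
  ∀ p q : K × K, (q.1 - p.1) * (q.2 - p.2) = 1 →
    ((g q).1 - (g p).1) * ((g q).2 - (g p).2) = 1

/-- Over a unit vector `c` there are at most two equilateral triangles, and their apexes add up
to `c`. -/
theorem equilateral_apex {K : Type*} [Field K] {a c d : K × K} (hc : c.1 * c.2 = 1)
    (ha : a.1 * a.2 = 1) (hac : (a.1 - c.1) * (a.2 - c.2) = 1)
    (hd : d.1 * d.2 = 1) (hdc : (d.1 - c.1) * (d.2 - c.2) = 1) : d = a ∨ d = c - a := by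
  -- `a.1 * c.2` and `d.1 * c.2` are roots of `X ^ 2 - X + 1`.
  have hr : (a.1 * c.2) ^ 2 - a.1 * c.2 + 1 = 0 := by
    linear_combination (-1) * a.1 * c.2 * hac + (a.1 * c.2 - c.1 * c.2) * ha
      + (a.1 * c.2 - 1) * hc
  have hs : (d.1 * c.2) ^ 2 - d.1 * c.2 + 1 = 0 := by
    linear_combination (-1) * d.1 * c.2 * hdc + (d.1 * c.2 - c.1 * c.2) * hd
      + (d.1 * c.2 - 1) * hc
  have ha2 : a.2 = (1 - a.1 * c.2) * c.2 := by
    linear_combination (-1) * c.2 * hac + c.2 * ha + (c.2 - a.2) * hc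
  have hd2 : d.2 = (1 - d.1 * c.2) * c.2 := by
    linear_combination (-1) * c.2 * hdc + c.2 * hd + (c.2 - d.2) * hc
  have h : (d.1 * c.2 - a.1 * c.2) * (d.1 * c.2 + a.1 * c.2 - 1) = 0 := by
    linear_combination hs - hr
  rcases mul_eq_zero.mp h with h | h
  · left
    ext
    · linear_combination c.1 * h - (d.1 - a.1) * hc
    · linear_combination hd2 - ha2 - c.2 * h
  · right
    ext
    · simp only [Prod.fst_sub]
      linear_combination c.1 * h - (d.1 + a.1) * hc
    · simp only [Prod.snd_sub]
      linear_combination hd2 + ha2 - c.2 * h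

theorem exists_root_quadratic {K : Type*} [Field K] [CharZero K] [IsAlgClosed K] (b c : K) :
    ∃ t : K, t ^ 2 - b * t + c = 0 := by
  obtain ⟨s, hs⟩ := IsAlgClosed.exists_pow_nat_eq (b ^ 2 - 4 * c) (n := 2) (by norm_num)
  exact ⟨(b + s) / 2, by linear_combination hs / 4⟩

/-- A unit rhombus whose short diagonal is a unit is mapped to a rhombus, unless its far vertices
are identified. -/
theorem PreservesHyperbolicUnit.rhombus_or_eq {K : Type*} [Field K] {g : K × K → K × K}
    (hg : PreservesHyperbolicUnit g) {ζ : K} (hζ : ζ ^ 2 - 1 * ζ + 1 = 0) (A : K × K) {w : K × K}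
    (hw : w.1 * w.2 = 1) :
    g (A + (w + (ζ * w.1, (1 - ζ) * w.2))) = g A ∨
      g (A + (w + (ζ * w.1, (1 - ζ) * w.2))) =
        g (A + w) + g (A + (ζ * w.1, (1 - ζ) * w.2)) - g A := by
  set w' : K × K := (ζ * w.1, (1 - ζ) * w.2) with hw'
  have h1 := hg A (A + w) (by simpa using hw)
  have h2 := hg A (A + w') (by
    simp only [hw', Prod.fst_add, Prod.snd_add]
    linear_combination (ζ - ζ ^ 2) * hw - hζ)
  have h3 := hg (A + w') (A + w) (by
    simp only [hw', Prod.fst_add, Prod.snd_add]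
    linear_combination (ζ - ζ ^ 2) * hw - hζ)
  have h4 := hg (A + w) (A + (w + w')) (by
    simp only [hw', Prod.fst_add, Prod.snd_add]
    linear_combination (ζ - ζ ^ 2) * hw - hζ)
  have h5 := hg (A + w') (A + (w + w')) (by
    simp only [Prod.fst_add, Prod.snd_add]
    linear_combination hw)
  rcases equilateral_apex (a := g A - g (A + w)) (c := g (A + w') - g (A + w))
      (d := g (A + (w + w')) - g (A + w))
      (by simp only [Prod.fst_sub, Prod.snd_sub]; linear_combination h3)
      (by simp only [Prod.fst_sub, Prod.snd_sub]; linear_combination h1)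
      (by simp only [Prod.fst_sub, Prod.snd_sub]; linear_combination h2)
      (by simp only [Prod.fst_sub, Prod.snd_sub]; linear_combination h4)
      (by simp only [Prod.fst_sub, Prod.snd_sub]; linear_combination h5) with h | h
  · left
    simpa using h
  · right
    rw [sub_eq_iff_eq_add.mp h]
    abel

/-- Vectors of norm `3` are long diagonals of unit rhombi, so their ends are identified or keep
their distance. -/
theorem PreservesHyperbolicUnit.norm_three_or_eq {K : Type*} [Field K] [CharZero K]
    {g : K × K → K × K} (hg : PreservesHyperbolicUnit g) {ζ : K} (hζ : ζ ^ 2 - 1 * ζ + 1 = 0)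
    (A : K × K) {p : K × K} (hp : p.1 * p.2 = 3) :
    g (A + p) = g A ∨
      ((g (A + p)).1 - (g A).1) * ((g (A + p)).2 - (g A).2) = 3 := by
  -- `1 + ζ` and `2 - ζ = 1 + ζ⁻¹` have product `3`.
  set w : K × K := ((2 - ζ) / 3 * p.1, (1 + ζ) / 3 * p.2) with hw
  have hw1 : w.1 * w.2 = 1 := by
    simp only [hw]
    linear_combination (2 - ζ) * (1 + ζ) / 9 * hp - hζ / 3
  have hsum : w + (ζ * w.1, (1 - ζ) * w.2) = p := by
    ext
    · simp only [hw, Prod.fst_add]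
      linear_combination (-1) * p.1 / 3 * hζ
    · simp only [hw, Prod.snd_add]
      linear_combination (-1) * p.2 / 3 * hζ
  have h := hg.rhombus_or_eq hζ A hw1
  have h1 := hg A (A + w) (by simpa using hw1)
  have h2 := hg A (A + (ζ * w.1, (1 - ζ) * w.2)) (by
    simp only [Prod.fst_add, Prod.snd_add]
    linear_combination (ζ - ζ ^ 2) * hw1 - hζ)
  have h3 := hg (A + (ζ * w.1, (1 - ζ) * w.2)) (A + w) (by
    simp only [Prod.fst_add, Prod.snd_add]
    linear_combination (ζ - ζ ^ 2) * hw1 - hζ)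
  rw [hsum] at h
  refine h.imp_right fun h => ?_
  rw [h]
  simp only [Prod.fst_add, Prod.snd_add, Prod.fst_sub, Prod.snd_sub]
  linear_combination 2 * h1 + 2 * h2 - h3

/-- Rhombi made of two equilateral unit triangles are mapped to rhombi. -/
theorem PreservesHyperbolicUnit.unit_rhombus {K : Type*} [Field K] [CharZero K] [IsAlgClosed K]
    {g : K × K → K × K} (hg : PreservesHyperbolicUnit g) {ζ : K} (hζ : ζ ^ 2 - 1 * ζ + 1 = 0)
    (A : K × K) {w : K × K} (hw : w.1 * w.2 = 1) :
    g (A + (w + (ζ * w.1, (1 - ζ) * w.2))) =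
      g (A + w) + g (A + (ζ * w.1, (1 - ζ) * w.2)) - g A := by
  refine (hg.rhombus_or_eq hζ A hw).resolve_left fun h => ?_
  set p : K × K := w + (ζ * w.1, (1 - ζ) * w.2) with hp
  have hp3 : p.1 * p.2 = 3 := by
    simp only [hp, Prod.fst_add, Prod.snd_add]
    linear_combination (1 + ζ) * (2 - ζ) * hw - hζ
  -- `κ + κ⁻¹ = 5 / 3`, so that `(κ p.1, κ⁻¹ p.2)` is at norm `3` from `0` and norm `1` from `p`.
  obtain ⟨κ, hκ⟩ := exists_root_quadratic (5 / 3 : K) 1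
  have hq : (κ * p.1) * ((5 / 3 - κ) * p.2) = 3 := by
    linear_combination κ * (5 / 3 - κ) * hp3 - 3 * hκ
  have h1 := hg (A + p) (A + (κ * p.1, (5 / 3 - κ) * p.2)) (by
    simp only [Prod.fst_add, Prod.snd_add]
    linear_combination (κ - 1) * (2 / 3 - κ) * hp3 - 3 * hκ)
  rw [h] at h1
  rcases hg.norm_three_or_eq hζ A (p := (κ * p.1, (5 / 3 - κ) * p.2)) hq with h2 | h2
  · rw [h2] at h1
    simp at h1
  · rw [h2] at h1
    norm_num at h1

/-! ### Additivity -/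

theorem PreservesHyperbolicUnit.map_add_two_unit {K : Type*} [Field K] [CharZero K] [IsAlgClosed K]
    {g : K × K → K × K} (hg : PreservesHyperbolicUnit g) (A : K × K) {w : K × K}
    (hw : w.1 * w.2 = 1) : g (A + w + w) = g (A + w) + g (A + w) - g A := by
  obtain ⟨ζ, hζ⟩ := exists_root_quadratic (1 : K) 1
  set w' : K × K := (ζ * w.1, (1 - ζ) * w.2) with hw'
  have h1 : g (A + (w + w')) = g (A + w) + g (A + w') - g A := hg.unit_rhombus hζ A hw
  -- The next rhombus of the strip starts at `A + w'` with side `w - w'`, which `ζ` rotates to `w`.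
  have hrot : (ζ * (w - w').1, (1 - ζ) * (w - w').2) = w := by
    ext
    · simp only [hw', Prod.fst_sub]
      linear_combination (-1) * w.1 * hζ
    · simp only [hw', Prod.snd_sub]
      linear_combination (-1) * w.2 * hζ
  have h2 := hg.unit_rhombus hζ (A + w') (w := w - w') (by
    simp only [hw', Prod.fst_sub, Prod.snd_sub]
    linear_combination (ζ - ζ ^ 2) * hw - hζ)
  rw [hrot, show A + w' + (w - w' + w) = A + w + w by abel,
    show A + w' + (w - w') = A + w by abel, show A + w' + w = A + (w + w') by abel, h1] at h2
  rw [h2]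
  abel

theorem PreservesHyperbolicUnit.map_add_unit_add_unit {K : Type*} [Field K] [CharZero K]
    [IsAlgClosed K] {g : K × K → K × K} (hg : PreservesHyperbolicUnit g) (A : K × K) {w w' : K × K}
    (hw : w.1 * w.2 = 1) (hw' : w'.1 * w'.2 = 1) :
    g (A + w' + w) - g (A + w') = g (A + w) - g A := by
  have e0 := hg A (A + w) (by simpa using hw)
  have e1 := hg (A + w') (A + w' + w) (by simpa using hw)
  have e2 := hg (A + w' + w') (A + w' + w' + w) (by simpa using hw)
  rw [show A + w' + w' + w = A + w + w' + w' by abel, hg.map_add_two_unit (A + w) hw',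
    hg.map_add_two_unit A hw', show A + w + w' = A + w' + w by abel] at e2
  obtain ⟨b, hb⟩ : ∃ b, b = g (A + w) - g A := ⟨_, rfl⟩
  obtain ⟨d, hd⟩ : ∃ d, d = (g (A + w' + w) - g (A + w')) - (g (A + w) - g A) := ⟨_, rfl⟩
  have hb1 : b.1 = (g (A + w)).1 - (g A).1 := by rw [hb]; rfl
  have hb2 : b.2 = (g (A + w)).2 - (g A).2 := by rw [hb]; rfl
  have hd1 : d.1 = ((g (A + w' + w)).1 - (g (A + w')).1) - ((g (A + w)).1 - (g A).1) := by
    rw [hd]; rfl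
  have hd2 : d.2 = ((g (A + w' + w)).2 - (g (A + w')).2) - ((g (A + w)).2 - (g A).2) := by
    rw [hd]; rfl
  have n0 : b.1 * b.2 = 1 := by rw [hb1, hb2]; exact e0
  have n1 : (b.1 + d.1) * (b.2 + d.2) = 1 := by
    rw [hb1, hb2, hd1, hd2]; linear_combination e1
  have n2 : (b.1 + 2 * d.1) * (b.2 + 2 * d.2) = 1 := by
    rw [hb1, hb2, hd1, hd2]
    simp only [Prod.fst_add, Prod.snd_add, Prod.fst_sub, Prod.snd_sub] at e2
    linear_combination e2
  have hdd : d.1 * d.2 = 0 := by linear_combination n2 / 2 - n1 + n0 / 2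
  have hbd : b.1 * d.2 + b.2 * d.1 = 0 := by linear_combination n1 - n0 - hdd
  have hd0 : d = 0 := by
    -- Multiply `hbd` by `d.1` or `d.2` and use that `b.1 * b.2 = 1`.
    have k1 : d.1 = 0 := by
      have : d.1 ^ 2 = 0 := by
        linear_combination b.1 * d.1 * hbd - b.1 ^ 2 * hdd - d.1 ^ 2 * n0
      exact pow_eq_zero_iff two_ne_zero |>.mp this
    have k2 : d.2 = 0 := by
      have : d.2 ^ 2 = 0 := by
        linear_combination b.2 * d.2 * hbd - b.2 ^ 2 * hdd - d.2 ^ 2 * n0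
      exact pow_eq_zero_iff two_ne_zero |>.mp this
    exact Prod.ext k1 k2
  rw [hd0] at hd
  exact sub_eq_zero.mp hd.symm

theorem closure_hyperbolic_unit_eq_top {K : Type*} [Field K] [CharZero K] [IsAlgClosed K] :
    AddSubgroup.closure {w : K × K | w.1 * w.2 = 1} = ⊤ := by
  set S := AddSubgroup.closure {w : K × K | w.1 * w.2 = 1}
  -- `(u, v) = (t, t⁻¹) + (s, s⁻¹)` where `t + s = u` and `t * s = u / v`.
  have hS : ∀ u v : K, u ≠ 0 → v ≠ 0 → (u, v) ∈ S := by
    intro u v hu hv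
    obtain ⟨t, ht⟩ := exists_root_quadratic u (u / v)
    have hts : t * (u - t) = u / v := by linear_combination -ht
    have hne : t * (u - t) ≠ 0 := hts ▸ div_ne_zero hu hv
    have ht0 := left_ne_zero_of_mul hne
    have hs0 := right_ne_zero_of_mul hne
    have h : (u, v) = ((t, t⁻¹) : K × K) + (u - t, (u - t)⁻¹) := by
      ext
      · simp
      · simp only [Prod.mk_add_mk]
        field_simp at hts ⊢
        apply mul_left_cancel₀ hu
        linear_combination u * hts
    rw [h]
    exact add_mem (AddSubgroup.subset_closure (mul_inv_cancel₀ ht0))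
      (AddSubgroup.subset_closure (mul_inv_cancel₀ hs0))
  have h1 : ∀ u : K, (u, 0) ∈ S := by
    intro u
    rcases eq_or_ne u 0 with rfl | hu
    · exact zero_mem S
    · have := sub_mem (hS (2 * u) 1 (by simpa using hu) one_ne_zero) (hS u 1 hu one_ne_zero)
      convert this using 1
      ext <;> simp [two_mul]
  have h2 : ∀ v : K, (0, v) ∈ S := by
    intro v
    rcases eq_or_ne v 0 with rfl | hv
    · exact zero_mem S
    · have := sub_mem (hS 1 (2 * v) one_ne_zero (by simpa using hv)) (hS 1 v one_ne_zero hv)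
      convert this using 1
      ext <;> simp [two_mul]
  refine (AddSubgroup.eq_top_iff' S).mpr fun p => ?_
  have := add_mem (h1 p.1) (h2 p.2)
  simpa using this

theorem PreservesHyperbolicUnit.map_add_sub_map_zero {K : Type*} [Field K] [CharZero K]
    [IsAlgClosed K] {g : K × K → K × K} (hg : PreservesHyperbolicUnit g) (p q : K × K) :
    g (p + q) - g 0 = (g p - g 0) + (g q - g 0) := by
  have mem : ∀ x : K × K, x ∈ AddSubgroup.closure {w : K × K | w.1 * w.2 = 1} := fun x => by
    rw [closure_hyperbolic_unit_eq_top]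
    trivial
  have unit : ∀ w : K × K, w.1 * w.2 = 1 → ∀ x A, g (A + x + w) - g (A + x) = g (A + w) - g A := by
    intro w hw x
    induction mem x using AddSubgroup.closure_induction with
    | mem y hy => exact fun A => hg.map_add_unit_add_unit A hw hy
    | zero => simp
    | add y z _ _ ihy ihz =>
      intro A
      rw [← add_assoc, ihz, ihy]
    | neg y _ ih =>
      intro A
      rw [← ih (A + -y), neg_add_cancel_right]
  have all : ∀ x A, g (A + x) - g A = g x - g 0 := by
    intro x
    induction mem x using AddSubgroup.closure_induction with
    | mem w hw =>
      intro A
      have := unit w hw A 0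
      simpa using this
    | zero => simp
    | add y z _ _ ihy ihz =>
      intro A
      rw [← add_assoc, ← sub_add_sub_cancel _ (g (A + y)), ihz, ihy,
        ← sub_add_sub_cancel (g (y + z)) (g y), ihz]
    | neg y _ ih =>
      intro A
      have h1 := ih (A + -y)
      have h2 := ih (0 + -y)
      rw [neg_add_cancel_right] at h1 h2
      rw [← neg_sub, h1, ← h2, zero_add, neg_sub]
  rw [← all q p]
  abel

/-! ### Additive maps preserving unit vectors -/

/-- A form of Hua's theorem: the identity `t⁻¹ - (t + 1)⁻¹ = (t ^ 2 + t)⁻¹` makes the normalized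
map `a 1⁻¹ * a` preserve squares, and polarization makes it multiplicative. -/
theorem exists_ringHom_of_mul_map_inv {K : Type*} [Field K] [CharZero K] (a d : K →+ K)
    (h : ∀ t : K, t ≠ 0 → a t * d t⁻¹ = 1) :
    ∃ (γ : K →+* K) (α : K), α ≠ 0 ∧ ∀ t, a t = α * γ t ∧ d t = α⁻¹ * γ t := by
  have ha0 : ∀ t, t ≠ 0 → a t ≠ 0 := fun t ht => left_ne_zero_of_mul_eq_one (h t ht)
  have hd : ∀ t, t ≠ 0 → d t⁻¹ = (a t)⁻¹ := fun t ht => eq_inv_of_mul_eq_one_right (h t ht)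
  have h1 := ha0 1 one_ne_zero
  have hsq : ∀ t, a (t ^ 2) * a 1 = a t ^ 2 := by
    intro t
    rcases eq_or_ne t 0 with rfl | ht
    · simp
    rcases eq_or_ne (t + 1) 0 with ht1 | ht1
    · rw [eq_neg_of_add_eq_zero_left ht1]
      simp [sq]
    · have e : (t ^ 2 + t)⁻¹ = t⁻¹ - (t + 1)⁻¹ := by
        rw [show t ^ 2 + t = t * (t + 1) by ring]
        field_simp
        ring
      have hs : t ^ 2 + t ≠ 0 := by
        rw [show t ^ 2 + t = t * (t + 1) by ring]
        exact mul_ne_zero ht ht1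
      have k := congrArg d e
      rw [map_sub, hd _ hs, hd t ht, hd _ ht1] at k
      have n1 := ha0 t ht
      have n2 := ha0 _ ht1
      have n3 := ha0 _ hs
      rw [map_add] at n2 n3
      rw [map_add, map_add] at k
      field_simp at k
      linear_combination -k
  have hmul : ∀ x y, a (x * y) * a 1 = a x * a y := by
    intro x y
    have k := hsq (x + y)
    rw [show (x + y) ^ 2 = x ^ 2 + (x * y + x * y) + y ^ 2 by ring] at k
    simp only [map_add] at k
    linear_combination k / 2 - hsq x / 2 - hsq y / 2
  let γ : K →+* K :=
    { toFun := fun t => (a 1)⁻¹ * a t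
      map_one' := inv_mul_cancel₀ h1
      map_mul' := fun x y => by
        field_simp
        linear_combination hmul x y
      map_zero' := by simp
      map_add' := fun x y => by rw [map_add, mul_add] }
  refine ⟨γ, a 1, h1, fun t => ⟨(mul_inv_cancel_left₀ h1 (a t)).symm, ?_⟩⟩
  change d t = (a 1)⁻¹ * ((a 1)⁻¹ * a t)
  rcases eq_or_ne t 0 with rfl | ht
  · simp
  · have k := hd t⁻¹ (inv_ne_zero ht)
    have m := hmul t⁻¹ t
    rw [inv_mul_cancel₀ ht] at m
    rw [inv_inv] at k
    rw [k]
    apply inv_eq_of_mul_eq_one_right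
    field_simp
    rw [one_div]
    linear_combination -m

/-- If the product of two additive maps vanishes identically, one of them does: an additive group is
not the union of two proper subgroups. -/
theorem AddMonoidHom.eq_zero_or_eq_zero_of_mul_eq_zero {K : Type*} [Field K] {a b : K →+ K}
    (h : ∀ t, a t * b t = 0) : (∀ t, a t = 0) ∨ ∀ t, b t = 0 := by
  by_contra! hne
  obtain ⟨⟨x, hx⟩, y, hy⟩ := hne
  have hbx : b x = 0 := (mul_eq_zero.mp (h x)).resolve_left hx
  have hay : a y = 0 := (mul_eq_zero.mp (h y)).resolve_right hy
  have k := h (x + y)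
  rw [map_add, map_add, hbx, hay, add_zero, zero_add] at k
  exact mul_ne_zero hx hy k

/-- An additive map of the hyperbolic plane preserving unit vectors is, up to exchanging the null
directions and scaling them reciprocally, a field homomorphism applied to both null coordinates. -/
theorem exists_ringHom_of_additive_hyperbolic {K : Type*} [Field K] [CharZero K]
    (h : K × K →+ K × K) (hu : ∀ p : K × K, p.1 * p.2 = 1 → (h p).1 * (h p).2 = 1) :
    ∃ (γ : K →+* K) (α : K), α ≠ 0 ∧
      ((∀ u v, h (u, v) = (α * γ u, α⁻¹ * γ v)) ∨ ∀ u v, h (u, v) = (α * γ v, α⁻¹ * γ u)) := by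
  let a : K →+ K := ((AddMonoidHom.fst K K).comp h).comp (AddMonoidHom.inl K K)
  let b : K →+ K := ((AddMonoidHom.fst K K).comp h).comp (AddMonoidHom.inr K K)
  let c : K →+ K := ((AddMonoidHom.snd K K).comp h).comp (AddMonoidHom.inl K K)
  let d : K →+ K := ((AddMonoidHom.snd K K).comp h).comp (AddMonoidHom.inr K K)
  have hh : ∀ u v, h (u, v) = (a u + b v, c u + d v) := by
    intro u v
    have e : ((u, v) : K × K) = (u, 0) + (0, v) := by simp
    rw [e, map_add]
    rfl
  have hsys : ∀ t : K, t ≠ 0 → a t * c t = 0 ∧ b t⁻¹ * d t⁻¹ = 0 ∧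
      a t * d t⁻¹ + b t⁻¹ * c t = 1 := by
    intro t ht
    have scaled : ∀ n : ℕ, n ≠ 0 →
        (n ^ 2 * a t + b t⁻¹) * (n ^ 2 * c t + d t⁻¹) = (n : K) ^ 2 := by
      intro n hn
      have hn' : (n : K) ≠ 0 := Nat.cast_ne_zero.mpr hn
      have k := hu (n * t, (n * t)⁻¹) (mul_inv_cancel₀ (mul_ne_zero hn' ht))
      have hl : ∀ φ : K →+ K, φ (n * t) = n * φ t := fun φ => by
        rw [← nsmul_eq_mul, map_nsmul, nsmul_eq_mul]
      have hr : ∀ φ : K →+ K, n * φ (n * t)⁻¹ = φ t⁻¹ := fun φ => by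
        rw [← nsmul_eq_mul, ← map_nsmul, nsmul_eq_mul, mul_inv, mul_inv_cancel_left₀ hn']
      rw [hh, hl, hl] at k
      rw [← hr b, ← hr d]
      linear_combination n ^ 2 * k
    have k1 := scaled 1 (by norm_num)
    have k2 := scaled 2 (by norm_num)
    have k3 := scaled 3 (by norm_num)
    push_cast at k1 k2 k3
    have hac : a t * c t = 0 := by
      linear_combination k1 / 24 - k2 / 15 + k3 / 40
    have hbd : b t⁻¹ * d t⁻¹ = 0 := by
      linear_combination (3 / 2) * k1 - (3 / 5) * k2 + k3 / 10
    exact ⟨hac, hbd, by linear_combination k1 - hac - hbd⟩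
  have hac : ∀ t, a t * c t = 0 := fun t => by
    rcases eq_or_ne t 0 with rfl | ht
    · simp
    · exact (hsys t ht).1
  have hbd : ∀ t, b t * d t = 0 := fun t => by
    rcases eq_or_ne t 0 with rfl | ht
    · simp
    · simpa using (hsys t⁻¹ (inv_ne_zero ht)).2.1
  have h1 : ∀ t, t ≠ 0 → a t * d t⁻¹ + b t⁻¹ * c t = 1 := fun t ht => (hsys t ht).2.2
  have one : (1 : K) ≠ 0 := one_ne_zero
  rcases AddMonoidHom.eq_zero_or_eq_zero_of_mul_eq_zero hac with ha | hc
  · have hd : ∀ t, d t = 0 := by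
      refine (AddMonoidHom.eq_zero_or_eq_zero_of_mul_eq_zero hbd).resolve_left fun hb => ?_
      simpa [ha, hb] using h1 1 one
    obtain ⟨γ, α, hα, hγ⟩ := exists_ringHom_of_mul_map_inv b c fun t ht => by
      simpa [ha] using h1 t⁻¹ (inv_ne_zero ht)
    refine ⟨γ, α, hα, Or.inr fun u v => ?_⟩
    rw [hh, ha, hd, zero_add, add_zero, (hγ v).1, (hγ u).2]
  · have hb : ∀ t, b t = 0 := by
      refine (AddMonoidHom.eq_zero_or_eq_zero_of_mul_eq_zero hbd).resolve_right fun hd => ?_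
      simpa [hc, hd] using h1 1 one
    obtain ⟨γ, α, hα, hγ⟩ := exists_ringHom_of_mul_map_inv a d fun t ht => by
      simpa [hc] using h1 t ht
    refine ⟨γ, α, hα, Or.inl fun u v => ?_⟩
    rw [hh, hb, hc, zero_add, add_zero, (hγ u).1, (hγ v).2]

/-- Endomorphisms of the unit-difference graph of the hyperbolic plane. -/
theorem PreservesHyperbolicUnit.exists_ringHom {K : Type*} [Field K] [CharZero K] [IsAlgClosed K]
    {g : K × K → K × K} (hg : PreservesHyperbolicUnit g) :
    ∃ (γ : K →+* K) (α : K), α ≠ 0 ∧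
      ((∀ u v, g (u, v) = (α * γ u, α⁻¹ * γ v) + g 0) ∨
        ∀ u v, g (u, v) = (α * γ v, α⁻¹ * γ u) + g 0) := by
  let h : K × K →+ K × K :=
    AddMonoidHom.mk' (fun p => g p - g 0) fun p q => hg.map_add_sub_map_zero p q
  obtain ⟨γ, α, hα, hγ⟩ := exists_ringHom_of_additive_hyperbolic h fun p hp => by
    have := hg 0 p (by simpa using hp)
    simpa [h] using this
  refine ⟨γ, α, hα, hγ.imp (fun H u v => ?_) (fun H u v => ?_)⟩ <;>
    exact sub_eq_iff_eq_add.mp (H u v)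

/-! ### Return to the coordinates of `ℂ²` -/

/-- The linear map of `ℂ²` whose null coordinates `u' = x₁' + i x₂'`, `v' = x₁' - i x₂'` are
`α (x₁ + ε i x₂)` and `α⁻¹ (x₁ - ε i x₂)`. -/
noncomputable def nullScaling (α ε : ℂ) : (Fin 2 → ℂ) →ₗ[ℂ] (Fin 2 → ℂ) where
  toFun x := ![(α * (x 0 + ε * Complex.I * x 1) + α⁻¹ * (x 0 - ε * Complex.I * x 1)) / 2,
    (α * (x 0 + ε * Complex.I * x 1) - α⁻¹ * (x 0 - ε * Complex.I * x 1)) / (2 * Complex.I)]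
  map_add' x y := by
    ext j
    fin_cases j <;> simp <;> ring
  map_smul' r x := by
    ext j
    fin_cases j <;> simp <;> ring

theorem isOrthogonalMap_nullScaling {α ε : ℂ} (hα : α ≠ 0) (hε : ε ^ 2 = 1) :
    IsOrthogonalMap (nullScaling α ε) := by
  intro x y
  simp only [nullScaling, LinearMap.coe_mk, AddHom.coe_mk, Matrix.cons_val_zero,
    Matrix.cons_val_one]
  have hI := Complex.I_sq
  have hI0 := Complex.I_ne_zero
  field_simp
  simp only [hI]
  linear_combination 4 * α ^ 2 * x 1 * y 1 * (Complex.I ^ 2 * hε + hI)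

theorem RingHom.map_I_eq_sign_mul (γ : ℂ →+* ℂ) :
    ∃ ε : ℂ, ε ^ 2 = 1 ∧ γ Complex.I = ε * Complex.I := by
  have h : γ Complex.I ^ 2 = Complex.I ^ 2 := by
    rw [← map_pow, Complex.I_sq, map_neg, map_one]
  rcases sq_eq_sq_iff_eq_or_eq_neg.mp h with h | h
  · exact ⟨1, by norm_num, by rw [h, one_mul]⟩
  · exact ⟨-1, by norm_num, by rw [h, neg_one_mul]⟩

theorem theorem3 (f : (Fin 2 → ℂ) → (Fin 2 → ℂ)) (hf : PreservesDistance 1 f) :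
    ∃ (γ : ℂ →+* ℂ) (I : (Fin 2 → ℂ) →ᵃ[ℂ] (Fin 2 → ℂ)),
      IsOrthogonalMap I.linear ∧ ∀ x₁ x₂ : ℂ, f ![x₁, x₂] = I ![γ x₁, γ x₂] := by
  have hI := Complex.I_sq
  have hI0 := Complex.I_ne_zero
  -- `e` passes to null coordinates and `e'` back.
  let e : (Fin 2 → ℂ) → ℂ × ℂ := fun x => (x 0 + Complex.I * x 1, x 0 - Complex.I * x 1)
  let e' : ℂ × ℂ → (Fin 2 → ℂ) := fun p => ![(p.1 + p.2) / 2, (p.1 - p.2) / (2 * Complex.I)]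
  have e'e : ∀ x₁ x₂ : ℂ, e' (x₁ + Complex.I * x₂, x₁ - Complex.I * x₂) = ![x₁, x₂] := by
    intro x₁ x₂
    ext j
    fin_cases j
    · simp [e']
    · simp only [e', Fin.mk_one, Matrix.cons_val_one, Matrix.cons_val_zero]
      field_simp
      ring
  have hg : PreservesHyperbolicUnit fun p => e (f (e' p)) := by
    intro p q hpq
    have k := hf (e' q) (e' p) (by
      simp only [phi, e', Matrix.cons_val_zero, Matrix.cons_val_one, Complex.ofReal_one]
      field_simp
      rw [hI]
      linear_combination (-4) * hpq)
    simp only [phi, Complex.ofReal_one] at k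
    simp only [e]
    linear_combination k - (f (e' q) 1 - f (e' p) 1) ^ 2 * hI
  obtain ⟨γ, α, hα, h⟩ := hg.exists_ringHom
  obtain ⟨ε, hε, hγI⟩ := γ.map_I_eq_sign_mul
  -- The exchange of the null directions is absorbed into the sign of `ε`.
  obtain ⟨δ, hδ, H⟩ : ∃ δ : ℂ, δ ^ 2 = 1 ∧ ∀ x₁ x₂ : ℂ, e (f ![x₁, x₂]) =
      (α * (γ x₁ + δ * Complex.I * γ x₂), α⁻¹ * (γ x₁ - δ * Complex.I * γ x₂)) +
        e (f (e' 0)) := by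
    rcases h with h | h
    · refine ⟨ε, hε, fun x₁ x₂ => ?_⟩
      rw [← e'e, h]
      simp only [map_add, map_sub, map_mul, hγI]
    · refine ⟨-ε, by rw [neg_sq, hε], fun x₁ x₂ => ?_⟩
      rw [← e'e, h]
      simp only [map_add, map_sub, map_mul, hγI, neg_mul, sub_neg_eq_add, ← sub_eq_add_neg]
  refine ⟨γ, (nullScaling α δ).toAffineMap + AffineMap.const ℂ _ (f (e' 0)), ?_, fun x₁ x₂ => ?_⟩
  · simpa using isOrthogonalMap_nullScaling hα hδ
  · have k := H x₁ x₂
    have k1 := congrArg Prod.fst k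
    have k2 := congrArg Prod.snd k
    simp only [e, Prod.mk_add_mk] at k1 k2
    ext j
    fin_cases j
    · simp [nullScaling]
      linear_combination k1 / 2 + k2 / 2
    · simp [nullScaling]
      generalize α⁻¹ = β at k1 k2 ⊢
      field_simp
      linear_combination k1 - k2
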